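/- For $\lambda\in(0,1)$ and $u\in\mathbb R$ let $G_\lambda(u)=\prod_{j=0}^{\infty}\cos(\pi\lambda^j u)$. A Pisot number is a real algebraic integer $\theta>1$ all of whose other Galois conjugates have modulus $<1$. Let $H$ denote the absolute multiplicative Weil height on algebraic numbers. Let $\lambda_1,\lambda_2\in(0,1)\setminus\{1/2\}$ be such that $\theta_1=\lambda_1^{-1}$ and $\theta_2=\lambda_2^{-1}$ are Pisot numbers, and let $\delta>0$ and $B>1$. Then there exist an integer $C_2\ge 2$ and positive constants $C_3,C_4,C_5,C_6,C_7$, depending only on $\lambda_1,\lambda_2,\delta,B$, with the following property. Let $(r_n)_n$ and $(s_n)_n$ be sequences of real numbers tending to $+\infty$ such that $$|G_{\lambda_1}(r_n)G_{\lambda_2}(s_n)|\ge\delta\quad\text{and}\quad r_n^{1/B}\le s_n\le r_n^{B}\quad\text{for every } n,$$ and for all sufficiently large $n$ write $$r_n=a_n\theta_1^{e_1(n)},\quad s_n=b_n\theta_2^{e_2(n)},\qquad e_1(n),e_2(n)\in\mathbb Z_{\ge 0},\quad 1\le a_n<\theta_1,\quad 1\le b_n<\theta_2.$$ Let $N>2$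 be an integer. Then for every sufficiently large $n$ (depending on $N$ and the sequences) there exist positive integers $k,\ell$ and numbers $\alpha\in\mathbb Q(\theta_1)$, $\beta\in\mathbb Q(\theta_2)$ (depending on $N$ and $n$) such that: - $\lfloor e_1(n)/N^{C_2}\rfloor\le k\le e_1(n)/N^2$, $\lfloor e_2(n)/N^{C_2}\rfloor\le \ell\le e_2(n)/N^2$, and $1/C_3<k/\ell<C_3$; - $|a_n-\alpha|\le C_5/\theta_1^{(N-2)k}$ and $H(\alpha)\le C_4\theta_1^{2k}$; - $|b_n-\beta|\le C_6/\theta_2^{(N-2)\ell}$ and $H(\beta)\le C_7\theta_2^{2\ell}$; - $1/2<\alpha<\theta_1+1/2$ and $1/2<\beta<\theta_2+1/2$. -/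

import Mathlib

open Filter Topology IntermediateField

/-- A Pisot number: a real algebraic integer `θ > 1` all of whose other Galois conjugates
(the other complex roots of its minimal polynomial over `ℚ`) have modulus `< 1`. -/
def IsPisot (θ : ℝ) : Prop :=
  1 < θ ∧ IsIntegral ℤ θ ∧
    ∀ z : ℂ, Polynomial.aeval z (minpoly ℚ θ) = 0 → z ≠ (θ : ℂ) → ‖z‖ < 1

/-- `G_λ(u) = ∏_{n ≥ 0} cos (π λ ^ n u)`, the Fourier transform of the Bernoulli convolution
with parameter `λ`, evaluated at `π u`. -/
noncomputable def salemG (lam u : ℝ) : ℝ :=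
  ∏' n : ℕ, Real.cos (Real.pi * lam ^ n * u)

/-- The infinite product defining `salemG` converges (absolutely) for `0 < λ < 1`. -/
theorem multipliable_salemG {lam : ℝ} (h0 : 0 < lam) (h1 : lam < 1) (u : ℝ) :
    Multipliable fun n : ℕ => Real.cos (Real.pi * lam ^ n * u) := by
  have hs : Summable fun n : ℕ => (Real.pi * u) ^ 2 / 2 * (lam ^ 2) ^ n :=
    (summable_geometric_of_lt_one (by positivity) (by nlinarith)).mul_left _
  have hb : Summable fun n : ℕ => Real.cos (Real.pi * lam ^ n * u) - 1 := by
    refine Summable.of_norm_bounded hs fun n => ?_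
    have h2 := Real.one_sub_sq_div_two_le_cos (x := Real.pi * lam ^ n * u)
    have h3 := Real.cos_le_one (Real.pi * lam ^ n * u)
    rw [Real.norm_eq_abs, abs_le]
    have h4 : (Real.pi * u) ^ 2 / 2 * (lam ^ 2) ^ n = (Real.pi * lam ^ n * u) ^ 2 / 2 := by
      rw [← pow_mul, mul_comm 2 n, pow_mul]; ring
    rw [h4]
    have h5 : 0 ≤ (Real.pi * lam ^ n * u) ^ 2 / 2 := by positivity
    constructor <;> linarith
  simpa using Real.multipliable_one_add_of_summable hb

/-! Both factors have modulus at most 1, so each is at least δ in modulus. For r = aθ^e the factors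
of G(r) include cos(π a θ^m) for every m ≤ e, so the number of m ≤ e with aθ^m at distance ≥ ε from
ℤ is bounded independently of r. The windows [e/N^i, N(e/N^i)) are disjoint, so by pigeonhole a
single i of bounded size gives windows free of such m for both sequences (`exists_common_window`); k
and ℓ are their left endpoints.

In such a window the nearest integers p_m to aθ^m satisfy the recurrence given by the minimal
polynomial f of θ, because f(shift) applied to p is an integer of modulus < 1. Write f = (X - θ)g
over ℚ(θ). Then g(shift)p is geometric of ratio θ, so g(shift)p_m = α g(θ) θ^m for one α in ℚ(θ)
(`shiftEval_factor_eq`). Near the right end of the window this forces a - α to be tiny. Near the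
left end, m = k, it bounds the conjugates and the denominator of α, hence its height
(`IsPisot.norm_map_le`, `IsPisot.absMulHeight₁_le`). -/

/-! ### Weil heights from a denominator and a bound on conjugates -/

-- Write x = a/n with a integral. Finite places of the pair (a, n) contribute at most 1, and each
-- infinite place at most nA to its multiplicity; the multiplicities add up to the degree.
open Height NumberField in
theorem mulHeight₁_le_of_isIntegral {K : Type*} [Field K] [NumberField K] (x : K) {n : ℕ}
    (hn : n ≠ 0) (hint : IsIntegral ℤ ((n : K) * x)) {A : ℝ} (hA : 1 ≤ A)
    (hx : ∀ φ : K →+* ℂ, ‖φ x‖ ≤ A) :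
    mulHeight₁ x ≤ (n * A) ^ Module.finrank ℚ K := by
  have hn' : (n : K) ≠ 0 := mod_cast hn
  obtain ⟨a, ha⟩ : ∃ a : 𝓞 K, n * x = a := ⟨⟨_, hint⟩, rfl⟩
  have hxa : x = (a : K) / ((n : 𝓞 K) : K) := by
    rw [← ha]; simp only [map_natCast]; field_simp
  rw [hxa, mulHeight₁_div_eq_mulHeight, NumberField.mulHeight_eq (x := ![(a : K), ((n : 𝓞 K) : K)]) (by simp [hn])]
  have hfin : ∏ᶠ v : FinitePlace K, ⨆ i, v (![(a : K), ((n : 𝓞 K) : K)] i) ≤ 1 := by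
    refine (finprod_induction (p := fun y : ℝ => 0 ≤ y ∧ y ≤ 1) ⟨zero_le_one, le_rfl⟩
      (fun y z hy hz => ⟨mul_nonneg hy.1 hz.1, mul_le_one₀ hy.2 hz.1 hz.2⟩) fun v => ?_).2
    have hle (b : 𝓞 K) : v b ≤ 1 := by
      rw [← FinitePlace.norm_embedding_eq]
      exact FinitePlace.norm_le_one K v.maximalIdeal b
    refine ⟨Real.iSup_nonneg fun i => apply_nonneg v _, ciSup_le fun i => ?_⟩
    fin_cases i
    · exact hle a
    · exact hle n
  have hinf : ∏ v : InfinitePlace K, (⨆ i, v (![(a : K), ((n : 𝓞 K) : K)] i)) ^ v.mult ≤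
      (n * A) ^ Module.finrank ℚ K := by
    rw [← InfinitePlace.sum_mult_eq, ← Finset.prod_pow_eq_pow_sum]
    refine Finset.prod_le_prod
      (fun v _ => pow_nonneg (Real.iSup_nonneg fun i => apply_nonneg v _) _) fun v _ => ?_
    refine pow_le_pow_left₀ (Real.iSup_nonneg fun i => apply_nonneg v _) (ciSup_le fun i => ?_) _
    fin_cases i
    · simp only [Fin.zero_eta, Matrix.cons_val_zero]
      rw [← ha, ← v.norm_embedding_eq, map_mul, norm_mul, map_natCast, Complex.norm_natCast]
      gcongr
      exact hx _
    · simp only [Fin.mk_one, Matrix.cons_val_one, Matrix.cons_val_fin_one, map_natCast]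
      rw [← v.norm_embedding_eq, map_natCast, Complex.norm_natCast]
      exact le_mul_of_one_le_right n.cast_nonneg hA
  calc _ ≤ (n * A) ^ Module.finrank ℚ K * 1 := by
        refine mul_le_mul hinf hfin ?_ (by positivity)
        exact finprod_nonneg fun v => Real.iSup_nonneg fun i => apply_nonneg v _
    _ = _ := mul_one _

open Height NumberField in
theorem absMulHeight₁_le_of_isIntegral {K : Type*} [Field K] [CharZero K] (x : K) {n : ℕ}
    (hn : n ≠ 0) (hint : IsIntegral ℤ ((n : K) * x)) {A : ℝ} (hA : 1 ≤ A)
    (hx : ∀ z : ℂ, Polynomial.aeval z (minpoly ℚ x) = 0 → ‖z‖ ≤ A) :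
    absMulHeight₁ x ≤ n * A := by
  have hn' : (1 : ℝ) ≤ n := mod_cast Nat.one_le_iff_ne_zero.mpr hn
  rw [absMulHeight₁]
  split_ifs with hxi
  · have : FiniteDimensional ℚ ℚ⟮x⟯ := adjoin.finiteDimensional hxi
    have : NumberField ℚ⟮x⟯ := {}
    have hd : Module.finrank ℚ ℚ⟮x⟯ ≠ 0 := Module.finrank_pos.ne'
    have key := mulHeight₁_le_of_isIntegral (AdjoinSimple.gen ℚ x) hn (A := A) ?_ hA ?_
    · calc _ ≤ ((n * A) ^ Module.finrank ℚ ℚ⟮x⟯) ^ (Module.finrank ℚ ℚ⟮x⟯ : ℝ)⁻¹ := by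
            gcongr
        _ = _ := Real.pow_rpow_inv_natCast (by positivity) hd
    · have hinj : Function.Injective ((ℚ⟮x⟯.val).restrictScalars ℤ) := (ℚ⟮x⟯.val).injective
      refine (isIntegral_algHom_iff _ hinj).mp ?_
      simpa using hint
    · intro φ
      apply hx
      have h1 := IntermediateField.aeval_gen_minpoly ℚ x
      have h2 := congrArg (φ.toRatAlgHom) h1
      rw [← Polynomial.aeval_algHom_apply] at h2
      simpa using h2
  -- This branch never occurs, since `n * x` is integral; the default value of the height meets the
  -- bound anyway.
  · nlinarith

/-- The value of the polynomial `q` at the shift operator, applied to the sequence `u` and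
read off at `0`: `∑ j, q.coeff j * u j`. -/
noncomputable def shiftEval {R : Type*} [CommRing R] (u : ℕ → R) : Polynomial R →ₗ[R] R :=
  Polynomial.lsum fun j => LinearMap.mulRight R (u j)

/-! ### Rules for polynomials in the shift operator -/

section shiftEval

open Polynomial

variable {R S : Type*} [CommRing R] [CommRing S]

theorem shiftEval_monomial (u : ℕ → R) (j : ℕ) (c : R) :
    shiftEval u (monomial j c) = c * u j := by
  simp [shiftEval]

theorem shiftEval_eq_sum (u : ℕ → R) (q : R[X]) :
    shiftEval u q = ∑ j ∈ Finset.range (q.natDegree + 1), q.coeff j * u j := by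
  conv_lhs => rw [q.as_sum_range, map_sum]
  simp only [shiftEval_monomial]

theorem shiftEval_X_mul (u : ℕ → R) (q : R[X]) :
    shiftEval u (X * q) = shiftEval (fun j => u (j + 1)) q := by
  induction q using Polynomial.induction_on' with
  | add p q hp hq => rw [mul_add, map_add, map_add, hp, hq]
  | monomial j c => rw [X_mul_monomial, shiftEval_monomial, shiftEval_monomial]

theorem shiftEval_C_mul (u : ℕ → R) (c : R) (q : R[X]) :
    shiftEval u (C c * q) = c * shiftEval u q := by
  rw [C_mul', map_smul, smul_eq_mul]

theorem shiftEval_sub (u v : ℕ → R) (q : R[X]) :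
    shiftEval (fun j => u j - v j) q = shiftEval u q - shiftEval v q := by
  simp only [shiftEval_eq_sum, mul_sub, Finset.sum_sub_distrib]

theorem shiftEval_geometric (a t : R) (q : R[X]) :
    shiftEval (fun j => a * t ^ j) q = a * q.eval t := by
  rw [shiftEval_eq_sum, eval_eq_sum_range, Finset.mul_sum]
  exact Finset.sum_congr rfl fun j _ => by ring

theorem map_shiftEval (φ : R →+* S) (u : ℕ → R) (q : R[X]) :
    φ (shiftEval u q) = shiftEval (fun j => φ (u j)) (q.map φ) := by
  induction q using Polynomial.induction_on' with
  | add p q hp hq => rw [Polynomial.map_add, map_add, map_add, map_add, hp, hq]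
  | monomial j c => rw [map_monomial, shiftEval_monomial, shiftEval_monomial, map_mul]

theorem norm_shiftEval_le {F : Type*} [NormedField F] (u : ℕ → F) (q : F[X]) {ε : ℝ}
    (hu : ∀ j ≤ q.natDegree, ‖u j‖ ≤ ε) :
    ‖shiftEval u q‖ ≤ (∑ j ∈ Finset.range (q.natDegree + 1), ‖q.coeff j‖) * ε := by
  rw [shiftEval_eq_sum, Finset.sum_mul]
  refine norm_sum_le_of_le _ fun j hj => ?_
  rw [norm_mul]
  gcongr
  exact hu j (Nat.lt_succ_iff.mp (Finset.mem_range.mp hj))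

end shiftEval

/-! ### Recurrences satisfied by nearest integers -/

section recurrence

open Polynomial NumberField

/-- Since f(shift) kills aθ^j, only the rounding errors contribute, and an integer of modulus < 1 is
zero. -/
theorem shiftEval_eq_zero_of_abs_sub_le {f : ℤ[X]} {θ a ε : ℝ}
    (hθ : (f.map (Int.castRingHom ℝ)).eval θ = 0) {p : ℕ → ℤ} {m : ℕ}
    (hp : ∀ j ≤ f.natDegree, |a * θ ^ (m + j) - p (m + j)| ≤ ε)
    (hε : (∑ j ∈ Finset.range (f.natDegree + 1), |(f.coeff j : ℝ)|) * ε < 1) :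
    shiftEval (fun j => p (m + j)) f = 0 := by
  have hdeg : (f.map (Int.castRingHom ℝ)).natDegree = f.natDegree :=
    natDegree_map_eq_of_injective (RingHom.injective_int _) f
  have h1 := norm_shiftEval_le (fun j => a * θ ^ m * θ ^ j - (p (m + j) : ℝ))
    (f.map (Int.castRingHom ℝ)) (ε := ε) fun j hj => by
      rw [mul_assoc, ← pow_add]
      exact hp j (hdeg ▸ hj)
  rw [shiftEval_sub, shiftEval_geometric, hθ, mul_zero, zero_sub, norm_neg, hdeg] at h1
  have h2 := map_shiftEval (Int.castRingHom ℝ) (fun j => p (m + j)) f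
  simp only [eq_intCast] at h2
  rw [← h2] at h1
  simp only [coeff_map, eq_intCast, Real.norm_eq_abs] at h1
  rw [← Int.abs_lt_one_iff]
  exact_mod_cast h1.trans_lt hε

/-- The recurrence says that (shift - t) annihilates g(shift)p, which is therefore geometric of
ratio t. -/
theorem shiftEval_factor_eq {R : Type*} [CommRing R] {f : ℤ[X]} {t : R} {g : R[X]}
    (hfg : f.map (Int.castRingHom R) = (X - C t) * g) {p : ℕ → ℤ} {k m : ℕ}
    (hkm : k ≤ m) (hp : ∀ i, k ≤ i → i < m → shiftEval (fun j => p (i + j)) f = 0) :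
    shiftEval (fun j => (p (m + j) : R)) g = t ^ (m - k) * shiftEval (fun j => (p (k + j) : R)) g := by
  induction m, hkm using Nat.le_induction with
  | base => simp
  | succ m hkm ih =>
    have h1 := congrArg (Int.castRingHom R) (hp m hkm m.lt_succ_self)
    rw [map_shiftEval, hfg, map_zero, sub_mul, map_sub, shiftEval_X_mul, shiftEval_C_mul] at h1
    simp only [eq_intCast] at h1
    rw [ih fun i hi him => hp i hi (him.trans m.lt_succ_self), sub_eq_zero] at h1
    rw [Nat.succ_sub hkm, pow_succ', mul_assoc, ← h1]
    congr 2
    ext j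
    rw [add_right_comm, add_assoc]

/-- Every embedding φ fixes the integers p, so the one real sequence aθ^m controls all conjugates of
γ simultaneously. -/
theorem norm_sub_le_of_mul_eq_shiftEval {K : Type*} [Field K] (φ : K →+* ℂ)
    {t γ : K} {g : K[X]} {θ a : ℝ} {p : ℕ → ℤ} {m : ℕ}
    (hγ : γ * g.eval t * t ^ m = shiftEval (fun j => (p (m + j) : K)) g)
    (hp : ∀ j ≤ g.natDegree, |a * θ ^ (m + j) - p (m + j)| ≤ 1) :
    ‖a * θ ^ m * (g.map φ).eval (θ : ℂ) - φ γ * φ (g.eval t) * φ t ^ m‖ ≤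
      ∑ j ∈ Finset.range (g.natDegree + 1), ‖φ (g.coeff j)‖ := by
  have h1 := norm_shiftEval_le (fun j => (a : ℂ) * θ ^ m * θ ^ j - (p (m + j) : ℂ))
    (g.map φ) (ε := 1) fun j hj => by
      have := hp j (by simpa using hj)
      rw [mul_assoc, ← pow_add, ← Real.norm_eq_abs, ← Complex.norm_real] at *
      simpa using this
  rw [shiftEval_sub, shiftEval_geometric] at h1
  have h2 := congrArg φ hγ
  rw [map_shiftEval] at h2
  simp only [map_mul, map_pow, map_intCast] at h2
  rw [h2]
  simpa using h1

end recurrence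

/-! ### Conjugates and constant term of a Pisot number -/

namespace IsPisot

open Polynomial NumberField

variable {θ : ℝ}

theorem isIntegral (h : IsPisot θ) : IsIntegral ℤ θ := h.2.1

theorem map_minpoly_int (h : IsPisot θ) :
    (minpoly ℤ θ).map (Int.castRingHom ℚ) = minpoly ℚ θ :=
  (minpoly.isIntegrallyClosed_eq_field_fractions' ℚ h.isIntegral).symm

theorem coeff_zero_minpoly_ne_zero (h : IsPisot θ) : (minpoly ℤ θ).coeff 0 ≠ 0 := by
  intro h0
  refine minpoly.coeff_zero_ne_zero (A := ℚ) h.isIntegral.tower_top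
    (zero_lt_one.trans h.1).ne' ?_
  rw [← h.map_minpoly_int, coeff_map, h0, map_zero]

theorem exists_roots_eq (h : IsPisot θ) :
    ∃ s : Multiset ℂ, ((minpoly ℤ θ).map (Int.castRingHom ℂ)).roots = (θ : ℂ) ::ₘ s ∧
      ∀ z ∈ s, ‖z‖ < 1 := by
  have hmap : (minpoly ℤ θ).map (Int.castRingHom ℂ) = (minpoly ℚ θ).map (algebraMap ℚ ℂ) := by
    rw [← h.map_minpoly_int, Polynomial.map_map]
    congr 1
  have hne : (minpoly ℚ θ).map (algebraMap ℚ ℂ) ≠ 0 :=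
    (Polynomial.map_ne_zero (minpoly.ne_zero h.isIntegral.tower_top))
  have hroot : (θ : ℂ) ∈ ((minpoly ℚ θ).map (algebraMap ℚ ℂ)).roots := by
    rw [mem_roots hne, IsRoot.def, eval_map_algebraMap]
    have := congrArg (algebraMap ℝ ℂ) (minpoly.aeval ℚ θ)
    rw [← aeval_algebraMap_apply] at this
    simpa using this
  have hsep : ((minpoly ℚ θ).map (algebraMap ℚ ℂ)).roots.Nodup :=
    nodup_roots ((minpoly.irreducible h.isIntegral.tower_top).separable.map)
  rw [hmap]
  obtain ⟨s, hs⟩ := Multiset.exists_cons_of_mem hroot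
  refine ⟨s, hs, fun z hz => ?_⟩
  rw [hs, Multiset.nodup_cons] at hsep
  refine h.2.2 z ?_ (fun hzθ => hsep.1 (hzθ ▸ hz))
  have : z ∈ ((minpoly ℚ θ).map (algebraMap ℚ ℂ)).roots := hs ▸ Multiset.mem_cons_of_mem hz
  rwa [mem_roots hne, IsRoot.def, eval_map_algebraMap] at this

theorem norm_coeff_zero (h : IsPisot θ) :
    |((minpoly ℤ θ).coeff 0 : ℝ)| =
      (((minpoly ℤ θ).map (Int.castRingHom ℂ)).roots.map fun z => ‖z‖).prod := by
  have h1 := (IsAlgClosed.splits ((minpoly ℤ θ).map (Int.castRingHom ℂ)))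
    |>.coeff_zero_eq_prod_roots_of_monic ((minpoly.monic h.isIntegral).map _)
  have h2 := congrArg norm h1
  rw [coeff_map, norm_mul, norm_pow, norm_neg, norm_one, one_pow, one_mul] at h2
  rw [← Real.norm_eq_abs, ← Complex.norm_real]
  rw [show (fun z : ℂ => ‖z‖) = normHom from rfl, Multiset.prod_hom]
  simpa using h2

theorem prod_norm_le_one {s : Multiset ℂ} (hs : ∀ z ∈ s, ‖z‖ < 1) :
    (s.map fun z => ‖z‖).prod ≤ 1 := by
  induction s using Multiset.induction_on with
  | empty => simp
  | cons z s ih =>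
    rw [Multiset.map_cons, Multiset.prod_cons]
    have hz := hs z (Multiset.mem_cons_self z s)
    have hs' := ih fun w hw => hs w (Multiset.mem_cons_of_mem hw)
    refine mul_le_one₀ hz.le (Multiset.prod_nonneg ?_) hs'
    simp only [Multiset.mem_map]
    rintro _ ⟨w, -, rfl⟩
    exact norm_nonneg w

theorem abs_coeff_zero_le (h : IsPisot θ) : |((minpoly ℤ θ).coeff 0 : ℝ)| ≤ θ := by
  obtain ⟨s, hs, hs1⟩ := h.exists_roots_eq
  have h0 : 0 < θ := zero_lt_one.trans h.1
  rw [h.norm_coeff_zero, hs, Multiset.map_cons, Multiset.prod_cons, Complex.norm_real,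
    Real.norm_eq_abs, abs_of_pos h0]
  exact mul_le_of_le_one_right h0.le (prod_norm_le_one hs1)

/-- The product of the moduli of all roots is a nonzero integer, and the roots other than θ and z
only decrease it. -/
theorem one_le_mul_norm_root (h : IsPisot θ) {z : ℂ}
    (hz : ((minpoly ℤ θ).map (Int.castRingHom ℂ)).eval z = 0) : 1 ≤ θ * ‖z‖ := by
  obtain ⟨s, hs, hs1⟩ := h.exists_roots_eq
  have h0 : 0 < θ := zero_lt_one.trans h.1
  have hmem : z ∈ (θ : ℂ) ::ₘ s := by
    rw [← hs, mem_roots ((minpoly.monic h.isIntegral).map _).ne_zero]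
    exact hz
  have hθ : ‖(θ : ℂ)‖ = θ := by rw [Complex.norm_real, Real.norm_eq_abs, abs_of_pos h0]
  rcases Multiset.mem_cons.mp hmem with rfl | hz
  · rw [hθ]
    nlinarith [h.1]
  · have hc : (1 : ℝ) ≤ |((minpoly ℤ θ).coeff 0 : ℝ)| := by
      exact_mod_cast Int.one_le_abs h.coeff_zero_minpoly_ne_zero
    obtain ⟨s', rfl⟩ := Multiset.exists_cons_of_mem hz
    rw [h.norm_coeff_zero, hs, Multiset.map_cons, Multiset.prod_cons, Multiset.map_cons,
      Multiset.prod_cons, hθ, ← mul_assoc] at hc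
    exact hc.trans (mul_le_of_le_one_right (by positivity)
      (prod_norm_le_one fun w hw => hs1 w (Multiset.mem_cons_of_mem hw)))

end IsPisot

/-! ### Conjugates and denominators of the approximant -/

namespace IsPisot

open Polynomial NumberField

variable {θ : ℝ}

theorem eval_minpoly_int (θ : ℝ) : ((minpoly ℤ θ).map (Int.castRingHom ℝ)).eval θ = 0 := by
  have := minpoly.aeval ℤ θ
  rwa [aeval_def, ← eval_map] at this

theorem eval_minpoly_int_of_injective {R : Type*} [CommRing R] (ψ : R →+* ℝ)
    (hψ : Function.Injective ψ) {t : R} (ht : ψ t = θ) :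
    ((minpoly ℤ θ).map (Int.castRingHom R)).eval t = 0 := by
  apply hψ
  have h1 := eval_minpoly_int θ
  have h2 := hom_eval₂ ((minpoly ℤ θ)) (Int.castRingHom R) ψ t
  rw [RingHom.eq_intCast' (ψ.comp (Int.castRingHom R)), ht, ← eval_map, ← eval_map, h1] at h2
  rw [h2, map_zero]

theorem norm_map_le (h : IsPisot θ) {K : Type*} [Field K] (φ : K →+* ℂ) {t γ : K} {g : K[X]}
    (hfg : (minpoly ℤ θ).map (Int.castRingHom K) = (X - C t) * g) (hg : g.eval t ≠ 0)
    {a : ℝ} (ha : 1 ≤ a) (haθ : a < θ) {p : ℕ → ℤ} {k : ℕ}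
    (hγ : γ * g.eval t * t ^ k = shiftEval (fun j => (p (k + j) : K)) g)
    (hp : ∀ j ≤ g.natDegree, |a * θ ^ (k + j) - p (k + j)| ≤ 1) :
    ‖φ γ‖ ≤ (θ + (∑ j ∈ Finset.range (g.natDegree + 1), ‖φ (g.coeff j)‖) / ‖φ (g.eval t)‖) *
      θ ^ k := by
  have h0 : 0 < θ := zero_lt_one.trans h.1
  have key := norm_sub_le_of_mul_eq_shiftEval φ hγ hp
  have hG : 0 < ‖φ (g.eval t)‖ := norm_pos_iff.mpr ((map_ne_zero φ).mpr hg)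
  have hS : 0 ≤ ∑ j ∈ Finset.range (g.natDegree + 1), ‖φ (g.coeff j)‖ :=
    Finset.sum_nonneg fun _ _ => norm_nonneg _
  set S := ∑ j ∈ Finset.range (g.natDegree + 1), ‖φ (g.coeff j)‖
  have hθk : 1 ≤ θ ^ k := one_le_pow₀ h.1.le
  have hfac : (minpoly ℤ θ).map (Int.castRingHom ℂ) = (X - C (φ t)) * g.map φ := by
    have := congrArg (Polynomial.map φ) hfg
    rw [Polynomial.map_map, RingHom.eq_intCast' (φ.comp (Int.castRingHom K))] at this
    simpa using this
  by_cases hz : φ t = θ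
  -- If φ fixes θ, then φ γ lies within a bounded distance of a < θ.
  · rw [← hz, eval_map_apply, hz, mul_right_comm, ← sub_mul, ← sub_mul, norm_mul, norm_mul,
      norm_pow, Complex.norm_real, Real.norm_eq_abs, abs_of_pos h0] at key
    have h1 : ‖(a : ℂ) - φ γ‖ ≤ S / ‖φ (g.eval t)‖ := by
      rw [le_div_iff₀ hG]
      exact (le_mul_of_one_le_right (by positivity) hθk).trans (by linarith)
    have h2 : ‖φ γ‖ ≤ ‖(a : ℂ)‖ + ‖(a : ℂ) - φ γ‖ := by
      simpa using norm_sub_le (a : ℂ) (a - φ γ)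
    rw [Complex.norm_real, Real.norm_eq_abs, abs_of_pos (zero_lt_one.trans_le ha)] at h2
    exact (by linarith : ‖φ γ‖ ≤ θ + S / ‖φ (g.eval t)‖).trans
      (le_mul_of_one_le_right (by positivity) hθk)
  -- Otherwise θ is a root of g^φ, the main term vanishes, and |φ t| ≥ 1/θ costs a factor θ^k.
  · have hθ : ((minpoly ℤ θ).map (Int.castRingHom ℂ)).eval (θ : ℂ) = 0 := by
      have := congrArg Complex.ofRealHom (eval_minpoly_int θ)
      rw [← eval_map_apply, Polynomial.map_map,
        RingHom.eq_intCast' (Complex.ofRealHom.comp (Int.castRingHom ℝ))] at this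
      simpa using this
    have hg0 : (g.map φ).eval (θ : ℂ) = 0 := by
      rw [hfac, eval_mul] at hθ
      refine (mul_eq_zero.mp hθ).resolve_left ?_
      rw [eval_sub, eval_X, eval_C]
      exact sub_ne_zero.mpr (Ne.symm hz)
    rw [hg0, mul_zero, zero_sub, norm_neg, norm_mul, norm_mul, norm_pow] at key
    have hzn : 1 ≤ θ * ‖φ t‖ := h.one_le_mul_norm_root (by rw [hfac]; simp)
    have h1 : ‖φ γ‖ * ‖φ (g.eval t)‖ ≤ S * θ ^ k := by
      calc ‖φ γ‖ * ‖φ (g.eval t)‖ ≤ ‖φ γ‖ * ‖φ (g.eval t)‖ * (θ * ‖φ t‖) ^ k :=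
            le_mul_of_one_le_right (by positivity) (one_le_pow₀ hzn)
        _ = ‖φ γ‖ * ‖φ (g.eval t)‖ * ‖φ t‖ ^ k * θ ^ k := by rw [mul_pow]; ring
        _ ≤ S * θ ^ k := by gcongr
    rw [add_mul, div_mul_eq_mul_div]
    rw [← le_div_iff₀ hG] at h1
    exact h1.trans (le_add_of_nonneg_left (by positivity))

theorem exists_minpoly_int_map_eq (h : IsPisot θ) {R : Type*} [CommRing R] [IsDomain R]
    (ψ : R →+* ℝ) (hψ : Function.Injective ψ) {t : R} (ht : ψ t = θ) :
    ∃ g : R[X], (minpoly ℤ θ).map (Int.castRingHom R) = (X - C t) * g ∧ g.eval t ≠ 0 := by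
  obtain ⟨g, hg⟩ := dvd_iff_isRoot.mpr (eval_minpoly_int_of_injective ψ hψ ht)
  refine ⟨g, hg, fun h0 => ?_⟩
  have h1 : (minpoly ℚ θ).Separable := (minpoly.irreducible h.isIntegral.tower_top).separable
  have h2 := h1.aeval_derivative_ne_zero (minpoly.aeval ℚ θ)
  have h3 : (minpoly ℚ θ).map (algebraMap ℚ ℝ) = (X - C θ) * g.map ψ := by
    rw [← h.map_minpoly_int, Polynomial.map_map]
    have := congrArg (Polynomial.map ψ) hg
    rw [Polynomial.map_map, RingHom.eq_intCast' (ψ.comp (Int.castRingHom R))] at this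
    rw [RingHom.eq_intCast' ((algebraMap ℚ ℝ).comp (Int.castRingHom ℚ)), this]
    simp [ht]
  rw [← eval_map_algebraMap, ← derivative_map, h3] at h2
  apply h2
  have h4 := eval_map_apply (f := ψ) (p := g) t
  rw [h0, ht, map_zero] at h4
  simp [h4]

/-- As f(t) = 0, the quotient is minus an integer polynomial in t. It clears the powers of t in
denominators even when t is not a unit. -/
theorem isIntegral_coeff_zero_div {K : Type*} [Field K] {t : K} (f : ℤ[X]) (ht0 : t ≠ 0)
    (ht : IsIntegral ℤ t) (hf : (f.map (Int.castRingHom K)).eval t = 0) :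
    IsIntegral ℤ ((f.coeff 0 : K) / t) := by
  have h1 : (f.coeff 0 : K) / t = -aeval t f.divX := by
    rw [div_eq_iff ht0]
    rw [← divX_mul_X_add f] at hf
    rw [Polynomial.map_add, Polynomial.map_mul, map_X, map_C, eval_add, eval_mul, eval_X, eval_C,
      eq_intCast] at hf
    rw [aeval_def, ← eval_map, algebraMap_int_eq]
    linear_combination hf
  rw [h1]
  refine IsIntegral.neg ?_
  rw [aeval_eq_sum_range]
  exact IsIntegral.sum _ fun i _ => (ht.pow i).smul _

end IsPisot

/-! ### Existence of good approximants of small height -/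

namespace IsPisot

open Polynomial NumberField

variable {θ : ℝ}

theorem absMulHeight₁_le (h : IsPisot θ) {K : Type*} [Field K] [NumberField K] (ψ : K →+* ℝ)
    {t γ G L : K} (ht : ψ t = θ) (hG : G ≠ 0) (hL : IsIntegral ℤ L) {k : ℕ}
    (hγ : γ * G * t ^ k = L) {D : ℕ} (hD : D ≠ 0) (hDG : IsIntegral ℤ ((D : K) / G))
    {A : ℝ} (hA : 1 ≤ A) (hφ : ∀ φ : K →+* ℂ, ‖φ γ‖ ≤ A * θ ^ k) :
    absMulHeight₁ (ψ γ) ≤ D * A * θ ^ (2 * k) := by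
  have h0 : 0 < θ := zero_lt_one.trans h.1
  have hψ : Function.Injective ψ := ψ.injective
  have ht0 : t ≠ 0 := fun h1 => by rw [h1, map_zero] at ht; exact h0.ne ht
  have htint : IsIntegral ℤ t := by
    have := h.isIntegral
    rw [← ht] at this
    exact (isIntegral_algHom_iff ψ.toIntAlgHom hψ).mp this
  set c := (minpoly ℤ θ).coeff 0 with hc
  have hcint : IsIntegral ℤ ((c : K) / t) :=
    isIntegral_coeff_zero_div _ ht0 htint (eval_minpoly_int_of_injective ψ hψ ht)
  have hint : IsIntegral ℤ ((D : K) * c ^ k * γ) := by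
    have : (D : K) * c ^ k * γ = D / G * (c / t) ^ k * L := by
      rw [← hγ, div_pow]
      field_simp
    rw [this]
    exact (hDG.mul (hcint.pow k)).mul hL
  have hint' : IsIntegral ℤ (((D * c.natAbs ^ k : ℕ) : ℝ) * ψ γ) := by
    have h1 : IsIntegral ℤ ((D : ℝ) * c ^ k * ψ γ) := by
      simpa using hint.map ψ.toIntAlgHom
    push_cast
    rw [Nat.cast_natAbs, Int.cast_abs]
    rcases abs_choice (c : ℝ) with h2 | h2 <;> rw [h2]
    · exact h1
    · have h3 : (D : ℝ) * (-(c : ℝ)) ^ k * ψ γ = ((-1) ^ k) * (D * c ^ k * ψ γ) := by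
        rw [neg_pow]; ring
      rw [h3]
      exact (isIntegral_one.neg.pow k).mul h1
  have hn : D * c.natAbs ^ k ≠ 0 :=
    mul_ne_zero hD (pow_ne_zero _ (Int.natAbs_ne_zero.mpr h.coeff_zero_minpoly_ne_zero))
  have hθk : 1 ≤ θ ^ k := one_le_pow₀ h.1.le
  refine (absMulHeight₁_le_of_isIntegral (ψ γ) hn hint' (A := A * θ ^ k)
    (one_le_mul_of_one_le_of_one_le hA hθk) fun z hz => ?_).trans ?_
  · have hmin : minpoly ℚ (ψ γ) = minpoly ℚ γ := minpoly.algHom_eq ψ.toRatAlgHom hψ γ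
    rw [hmin] at hz
    have hz' : z ∈ (minpoly ℚ γ).rootSet ℂ :=
      mem_rootSet.mpr ⟨minpoly.ne_zero (.of_finite ℚ γ), hz⟩
    rw [← Embeddings.range_eval_eq_rootSet_minpoly K ℂ γ] at hz'
    obtain ⟨φ, rfl⟩ := hz'
    exact hφ φ
  -- The denominator D|c|^k and the conjugate bound Aθ^k each contribute one θ^k, whence the
  -- exponent 2k.
  · have hcθ : (c.natAbs : ℝ) ≤ θ := by
      rw [Nat.cast_natAbs, Int.cast_abs]
      exact h.abs_coeff_zero_le
    push_cast
    calc (D : ℝ) * (c.natAbs : ℝ) ^ k * (A * θ ^ k) ≤ D * θ ^ k * (A * θ ^ k) := by gcongr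
      _ = D * A * θ ^ (2 * k) := by rw [two_mul, pow_add]; ring

theorem exists_approx (h : IsPisot θ) :
    ∃ (ε C C' : ℝ) (K₀ : ℕ), 0 < ε ∧ ε ≤ 1 / 2 ∧ 0 < C ∧ 0 < C' ∧
      ∀ (a : ℝ) (N k : ℕ), 1 ≤ a → a < θ → 2 < N → K₀ ≤ k →
        (∀ m, k ≤ m → m < N * k → |a * θ ^ m - round (a * θ ^ m)| < ε) →
        ∃ α ∈ ℚ⟮θ⟯, |a - α| ≤ C' / θ ^ ((N - 2) * k) ∧ absMulHeight₁ α ≤ C * θ ^ (2 * k) ∧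
          1 / 2 < α ∧ α < θ + 1 / 2 := by
  have h0 : 0 < θ := zero_lt_one.trans h.1
  have : FiniteDimensional ℚ ℚ⟮θ⟯ := adjoin.finiteDimensional h.isIntegral.tower_top
  have : NumberField ℚ⟮θ⟯ := {}
  let ψ : ℚ⟮θ⟯ →+* ℝ := algebraMap ℚ⟮θ⟯ ℝ
  have hψ : Function.Injective ψ := ψ.injective
  let t : ℚ⟮θ⟯ := AdjoinSimple.gen ℚ θ
  have ht : ψ t = θ := rfl
  have htint : IsIntegral ℤ t :=
    (isIntegral_algHom_iff ψ.toIntAlgHom hψ).mp h.isIntegral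
  -- Factoring over the ring of integers gives g integral coefficients, so that L below is integral.
  let t' : 𝓞 ℚ⟮θ⟯ := ⟨t, htint⟩
  let ι : 𝓞 ℚ⟮θ⟯ →+* ℚ⟮θ⟯ := algebraMap (𝓞 ℚ⟮θ⟯) ℚ⟮θ⟯
  have hι : Function.Injective ι := RingOfIntegers.coe_injective
  have hιt : ι t' = t := rfl
  obtain ⟨g', hfg', hg'⟩ := h.exists_minpoly_int_map_eq (ψ.comp ι) (hψ.comp hι) (t := t') ht
  set f := minpoly ℤ θ with hf
  set g : ℚ⟮θ⟯[X] := g'.map ι with hgdef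
  have hfg : f.map (Int.castRingHom ℚ⟮θ⟯) = (X - C t) * g := by
    have := congrArg (Polynomial.map ι) hfg'
    rw [Polynomial.map_map, RingHom.eq_intCast' (ι.comp (Int.castRingHom _))] at this
    simpa [hιt] using this
  have hGι : g.eval t = ι (g'.eval t') := by rw [hgdef, ← hιt, eval_map_apply]
  have hg : g.eval t ≠ 0 := by
    rw [hGι]
    exact (map_ne_zero_iff ι hι).mpr hg'
  obtain ⟨D, hD, hDG⟩ : ∃ D : ℕ, D ≠ 0 ∧ IsIntegral ℤ ((D : ℚ⟮θ⟯) / g.eval t) := by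
    have halg : IsAlgebraic ℤ (g.eval t)⁻¹ :=
      (IsFractionRing.isAlgebraic_iff ℤ ℚ _).mpr (.of_finite ℚ _)
    obtain ⟨y, hy, hyi⟩ := halg.exists_integral_multiple
    refine ⟨y.natAbs, Int.natAbs_ne_zero.mpr hy, ?_⟩
    rw [div_eq_mul_inv, Nat.cast_natAbs]
    rcases abs_choice y with h2 | h2 <;> rw [h2]
    · simpa using hyi
    · simpa using hyi.neg
  let S (φ : ℚ⟮θ⟯ →+* ℂ) : ℝ := ∑ j ∈ Finset.range (g.natDegree + 1), ‖φ (g.coeff j)‖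
  have hS φ : 0 ≤ S φ := Finset.sum_nonneg fun _ _ => norm_nonneg _
  have hnG (φ : ℚ⟮θ⟯ →+* ℂ) : 0 < ‖φ (g.eval t)‖ :=
    norm_pos_iff.mpr ((map_ne_zero φ).mpr hg)
  let A : ℝ := θ + ∑ φ : ℚ⟮θ⟯ →+* ℂ, S φ / ‖φ (g.eval t)‖
  have hA : θ ≤ A := le_add_of_nonneg_right
    (Finset.sum_nonneg fun φ _ => div_nonneg (hS φ) (norm_nonneg _))
  let φ₀ : ℚ⟮θ⟯ →+* ℂ := Complex.ofRealHom.comp ψ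
  -- Safety margin: indices at most deg f or deg g beyond Nk - d stay inside the window.
  let d := f.natDegree + g.natDegree + 1
  let C' : ℝ := S φ₀ / ‖φ₀ (g.eval t)‖ * θ ^ d + 1
  have hC' : 0 < C' := by
    have := div_nonneg (hS φ₀) (hnG φ₀).le
    positivity
  let s : ℝ := ∑ j ∈ Finset.range (f.natDegree + 1), |(f.coeff j : ℝ)|
  have hs : 0 ≤ s := Finset.sum_nonneg fun _ _ => abs_nonneg _
  -- With s the sum of the |coefficients| of f, this ε makes sε < 1, as the recurrence requires.
  have hε : 1 / (2 * (1 + s)) ≤ 1 / 2 :=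
    one_div_le_one_div_of_le two_pos (by linarith)
  have hsε : s * (1 / (2 * (1 + s))) < 1 := by
    rw [mul_one_div, div_lt_one (by positivity)]
    linarith
  obtain ⟨K₁, hK₁⟩ := pow_unbounded_of_one_lt (2 * C') h.1
  refine ⟨1 / (2 * (1 + s)), D * A, C', max d K₁, by positivity, hε, ?_, hC', ?_⟩
  · have : 0 < A := h0.trans_le hA
    positivity
  intro a N k ha haθ hN hk hwin
  have hdk : d ≤ k := (le_max_left _ _).trans hk
  have hNk : 3 * k ≤ N * k := Nat.mul_le_mul_right k hN
  let p : ℕ → ℤ := fun m => round (a * θ ^ m)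
  have hpk j (hj : j ≤ g.natDegree) : |a * θ ^ (k + j) - p (k + j)| ≤ 1 :=
    (hwin _ (by omega) (by omega)).le.trans (by linarith)
  have hpm j (hj : j ≤ g.natDegree) :
      |a * θ ^ (N * k - d + j) - p (N * k - d + j)| ≤ 1 :=
    (hwin _ (by omega) (by omega)).le.trans (by linarith)
  have hrec := shiftEval_factor_eq hfg (p := p) (k := k) (m := N * k - d) (by omega)
    fun i hki hi => shiftEval_eq_zero_of_abs_sub_le (eval_minpoly_int θ)
      (fun j (hj : j ≤ f.natDegree) => (hwin _ (by omega) (by omega)).le) hsε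
  have ht0 : t ≠ 0 := fun h1 => by rw [h1, map_zero] at ht; exact h0.ne ht
  set L := shiftEval (fun j => (p (k + j) : ℚ⟮θ⟯)) g with hL
  have hLint : IsIntegral ℤ L := by
    have h1 := map_shiftEval ι (fun j => (p (k + j) : 𝓞 ℚ⟮θ⟯)) g'
    simp only [map_intCast] at h1
    rw [hL, hgdef, ← h1]
    exact RingOfIntegers.isIntegral_coe _
  let γ : ℚ⟮θ⟯ := L / (g.eval t * t ^ k)
  have hγk : γ * g.eval t * t ^ k = L := by
    simp only [γ]
    field_simp
  have hγm : γ * g.eval t * t ^ (N * k - d) =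
      shiftEval (fun j => (p (N * k - d + j) : ℚ⟮θ⟯)) g := by
    rw [hrec, ← hγk]
    nth_rewrite 1 [show N * k - d = N * k - d - k + k by omega]
    rw [pow_add]
    ring
  have hconj (φ : ℚ⟮θ⟯ →+* ℂ) : ‖φ γ‖ ≤ A * θ ^ k := by
    refine (h.norm_map_le φ hfg hg ha haθ hγk hpk).trans ?_
    refine mul_le_mul_of_nonneg_right (add_le_add_right ?_ θ) (by positivity)
    exact Finset.single_le_sum (f := fun φ : ℚ⟮θ⟯ →+* ℂ => S φ / ‖φ (g.eval t)‖)
      (fun φ _ => div_nonneg (hS φ) (norm_nonneg _)) (Finset.mem_univ φ)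
  have hdist : |a - ψ γ| ≤ C' / θ ^ ((N - 2) * k) := by
    have h1 := norm_sub_le_of_mul_eq_shiftEval φ₀ hγm hpm
    have h2 : φ₀ t = (θ : ℂ) := rfl
    rw [← h2, eval_map_apply, h2, mul_right_comm, ← sub_mul, ← sub_mul, norm_mul, norm_mul,
      norm_pow, Complex.norm_real θ, Real.norm_eq_abs, abs_of_pos h0,
      show (a : ℂ) - φ₀ γ = ((a - ψ γ : ℝ) : ℂ) by simp [φ₀], Complex.norm_real,
      Real.norm_eq_abs] at h1
    have h3 : |a - ψ γ| * θ ^ (N * k) ≤ S φ₀ / ‖φ₀ (g.eval t)‖ * θ ^ d := by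
      rw [show N * k = N * k - d + d by omega, pow_add, ← mul_assoc]
      gcongr
      rw [le_div_iff₀ (hnG φ₀)]
      linarith
    rw [le_div_iff₀ (by positivity)]
    -- The argument yields the exponent Nk; it is weakened to (N - 2)k.
    calc |a - ψ γ| * θ ^ ((N - 2) * k) ≤ |a - ψ γ| * θ ^ (N * k) := by
          gcongr
          · exact h.1.le
          · omega
      _ ≤ C' := h3.trans (by linarith)
  refine ⟨ψ γ, γ.2, hdist, ?_, ?_⟩
  · exact h.absMulHeight₁_le ψ ht hg hLint hγk hD hDG (h.1.le.trans hA) hconj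
  · have h1 : |a - ψ γ| < 1 / 2 := by
      refine hdist.trans_lt ?_
      rw [div_lt_iff₀ (by positivity)]
      have h2 : θ ^ K₁ ≤ θ ^ ((N - 2) * k) := by
        refine pow_le_pow_right₀ h.1.le (((le_max_right _ _).trans hk).trans ?_)
        exact Nat.le_mul_of_pos_left k (by omega)
      linarith
    rw [abs_lt] at h1
    constructor <;> linarith

end IsPisot

/-! ### Few exponents far from integers, and common windows -/

theorem abs_cos_pi_mul_le_of_le_abs_sub_round {x ε : ℝ} (hε : 0 ≤ ε) (hx : ε ≤ |x - round x|) :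
    |Real.cos (Real.pi * x)| ≤ Real.cos (Real.pi * ε) := by
  have h1 : |Real.cos (Real.pi * x)| = |Real.cos (Real.pi * |x - round x|)| := by
    have h2 : Real.pi * |x - round x| = |Real.pi * x - round x * Real.pi| := by
      rw [mul_comm (round x : ℝ), ← mul_sub, abs_mul, abs_of_pos Real.pi_pos]
    rw [h2, Real.cos_abs, Real.cos_sub_int_mul_pi, abs_mul, abs_zpow, abs_neg, abs_one, one_zpow,
      one_mul]
  have h3 := abs_sub_round x
  have hπ := Real.pi_pos
  rw [h1, abs_of_nonneg (Real.cos_nonneg_of_mem_Icc ⟨by nlinarith, by nlinarith⟩)]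
  refine Real.cos_le_cos_of_nonneg_of_le_pi (by positivity) (by nlinarith) (by gcongr)

theorem abs_salemG_le_prod {lam : ℝ} (h0 : 0 < lam) (h1 : lam < 1) (u : ℝ) (s : Finset ℕ) :
    |salemG lam u| ≤ ∏ n ∈ s, |Real.cos (Real.pi * lam ^ n * u)| := by
  have h2 := ((multipliable_salemG h0 h1 u).hasProd).abs
  refine le_of_tendsto h2 ?_
  filter_upwards [eventually_ge_atTop s] with s' hs
  rw [← Finset.prod_sdiff hs]
  exact mul_le_of_le_one_left (Finset.prod_nonneg fun _ _ => abs_nonneg _)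
    (Finset.prod_le_one (fun _ _ => abs_nonneg _) fun _ _ => Real.abs_cos_le_one _)

theorem abs_salemG_le_one {lam : ℝ} (h0 : 0 < lam) (h1 : lam < 1) (u : ℝ) : |salemG lam u| ≤ 1 := by
  simpa using abs_salemG_le_prod h0 h1 u ∅

/-- The exponent m ≤ e corresponds to the factor of index e - m. Each far exponent contributes a
factor at most q = cos(πε) < 1, and M is chosen with q^M < δ. -/
theorem exists_card_far_from_int_le {θ δ ε : ℝ} (hθ : 1 < θ) (hδ : 0 < δ) (hε : 0 < ε)
    (hε' : ε ≤ 1 / 2) :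
    ∃ M : ℕ, ∀ (a : ℝ) (e : ℕ), δ ≤ |salemG θ⁻¹ (a * θ ^ e)| → ∀ s : Finset ℕ,
      (∀ m ∈ s, m ≤ e ∧ ε ≤ |a * θ ^ m - round (a * θ ^ m)|) → s.card ≤ M := by
  have h0 : 0 < θ := zero_lt_one.trans hθ
  have hπ := Real.pi_pos
  have hq0 : 0 ≤ Real.cos (Real.pi * ε) :=
    Real.cos_nonneg_of_mem_Icc ⟨by nlinarith, by nlinarith⟩
  have hq1 : Real.cos (Real.pi * ε) < 1 := by
    rw [← Real.cos_zero]
    exact Real.cos_lt_cos_of_nonneg_of_le_pi le_rfl (by nlinarith) (by positivity)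
  obtain ⟨M, hM⟩ := exists_pow_lt_of_lt_one hδ hq1
  refine ⟨M, fun a e hG s hs => ?_⟩
  by_contra! hcard
  have hinj : Set.InjOn (fun m => e - m) (s : Set ℕ) := fun x hx y hy hxy => by
    have := (hs x hx).1
    have := (hs y hy).1
    simp only at hxy
    omega
  have h1 := abs_salemG_le_prod (inv_pos.mpr h0) (inv_lt_one_of_one_lt₀ hθ) (a * θ ^ e)
    (s.image fun m => e - m)
  rw [Finset.prod_image hinj] at h1
  have h2 : ∏ m ∈ s, |Real.cos (Real.pi * θ⁻¹ ^ (e - m) * (a * θ ^ e))| ≤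
      ∏ _m ∈ s, Real.cos (Real.pi * ε) := by
    refine Finset.prod_le_prod (fun _ _ => abs_nonneg _) fun m hm => ?_
    have h3 : Real.pi * θ⁻¹ ^ (e - m) * (a * θ ^ e) = Real.pi * (a * θ ^ m) := by
      rw [inv_pow, ← Nat.sub_add_cancel (hs m hm).1, pow_add, Nat.add_sub_cancel]
      field_simp
    rw [h3]
    exact abs_cos_pi_mul_le_of_le_abs_sub_round hε.le (hs m hm).2
  rw [Finset.prod_const] at h2
  have h4 := pow_le_pow_of_le_one hq0 hq1.le hcard.le
  linarith

/-- The windows `[e / N ^ i, N * (e / N ^ i))` are pairwise disjoint, so that a set with at most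
`M` elements meets at most `M` of them. -/
theorem card_windows_le {e N M : ℕ} {P : ℕ → Prop}
    (hP : ∀ s : Finset ℕ, (∀ m ∈ s, m ≤ e ∧ P m) → s.card ≤ M) (I : Finset ℕ)
    (hI : ∀ i ∈ I, 1 ≤ i ∧ ∃ m, e / N ^ i ≤ m ∧ m < N * (e / N ^ i) ∧ P m) : I.card ≤ M := by
  choose! hi w hw1 hw2 hw3 using hI
  have hN (i : ℕ) : N * (e / N ^ (i + 1)) ≤ e / N ^ i := by
    rw [pow_succ, ← Nat.div_div_eq_div_mul]
    exact Nat.mul_div_le _ _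
  have hanti : Antitone fun i => e / N ^ i := by
    refine antitone_nat_of_succ_le fun i => ?_
    rcases N.eq_zero_or_pos with rfl | hN0
    · simp
    · exact (Nat.le_mul_of_pos_left _ hN0).trans (hN i)
  have hlt : ∀ i ∈ I, ∀ j ∈ I, i < j → w j < w i := fun i hi' j hj hij => by
    have h1 := hw2 j hj
    have h2 := hN (j - 1)
    rw [Nat.sub_add_cancel (hi j hj)] at h2
    have h3 : e / N ^ (j - 1) ≤ e / N ^ i := hanti (by omega)
    exact (h1.trans_le (h2.trans h3)).trans_le (hw1 i hi')
  have hinj : Set.InjOn w (I : Set ℕ) := fun i hi' j hj hij => by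
    rcases lt_trichotomy i j with h | h | h
    · exact absurd hij (hlt i hi' j hj h).ne'
    · exact h
    · exact absurd hij (hlt j hj i hi' h).ne
  classical
  rw [← Finset.card_image_of_injOn hinj]
  refine hP _ fun m hm => ?_
  obtain ⟨i, hi', rfl⟩ := Finset.mem_image.mp hm
  refine ⟨?_, hw3 i hi'⟩
  have h1 := hw2 i hi'
  have h2 := hN (i - 1)
  rw [Nat.sub_add_cancel (hi i hi')] at h2
  exact h1.le.trans (h2.trans (Nat.div_le_self _ _))

/-- Among the M₁ + M₂ + 1 indices from 2 to M₁ + M₂ + 2, at most M₁ fail for the first family and M₂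
for the second. Starting at 2 gives the upper bound e/N² later. -/
theorem exists_common_window {e₁ e₂ N M₁ M₂ : ℕ} {P₁ P₂ : ℕ → Prop}
    (hP₁ : ∀ s : Finset ℕ, (∀ m ∈ s, m ≤ e₁ ∧ P₁ m) → s.card ≤ M₁)
    (hP₂ : ∀ s : Finset ℕ, (∀ m ∈ s, m ≤ e₂ ∧ P₂ m) → s.card ≤ M₂) :
    ∃ i, 2 ≤ i ∧ i ≤ M₁ + M₂ + 2 ∧
      (∀ m, e₁ / N ^ i ≤ m → m < N * (e₁ / N ^ i) → ¬ P₁ m) ∧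
      (∀ m, e₂ / N ^ i ≤ m → m < N * (e₂ / N ^ i) → ¬ P₂ m) := by
  classical
  by_contra! hcon
  let J := Finset.Icc 2 (M₁ + M₂ + 2)
  let Q (i : ℕ) : Prop := ∃ m, e₁ / N ^ i ≤ m ∧ m < N * (e₁ / N ^ i) ∧ P₁ m
  have h1 : (J.filter Q).card ≤ M₁ := card_windows_le hP₁ _ fun i hi => by
    rw [Finset.mem_filter, Finset.mem_Icc] at hi
    exact ⟨by omega, hi.2⟩
  have h2 : (J.filter fun i => ¬ Q i).card ≤ M₂ := card_windows_le hP₂ _ fun i hi => by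
    rw [Finset.mem_filter, Finset.mem_Icc] at hi
    exact ⟨by omega, hcon i hi.1.1 hi.1.2 fun m hm1 hm2 hm3 => hi.2 ⟨m, hm1, hm2, hm3⟩⟩
  have h3 := Finset.card_filter_add_card_filter_not (s := J) Q
  rw [Nat.card_Icc] at h3
  omega

/-! ### Size of exponents and their ratios -/

theorem eventually_le_exponent {θ : ℝ} (hθ : 1 < θ) {r a : ℕ → ℝ} {e : ℕ → ℕ}
    (hr : Tendsto r atTop atTop)
    (h : ∀ᶠ n in atTop, r n = a n * θ ^ e n ∧ 1 ≤ a n ∧ a n < θ) (K : ℕ) :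
    ∀ᶠ n in atTop, K ≤ e n := by
  filter_upwards [h, hr.eventually_ge_atTop (θ ^ K)] with n ⟨h1, h2, h3⟩ h4
  have h5 : θ ^ K < θ ^ (e n + 1) := by
    rw [pow_succ']
    refine (h4.trans h1.le).trans_lt ?_
    gcongr
  have := (pow_lt_pow_iff_right₀ hθ).mp h5
  omega

theorem mul_log_le_log {θ a r : ℝ} {e : ℕ} (hθ : 1 < θ) (hr : r = a * θ ^ e) (ha : 1 ≤ a) :
    e * Real.log θ ≤ Real.log r := by
  rw [← Real.log_pow, hr]
  have : 0 < θ ^ e := by positivity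
  exact Real.log_le_log this (le_mul_of_one_le_left this.le ha)

theorem log_le_two_mul_log {θ a r : ℝ} {e : ℕ} (hθ : 1 < θ) (hr : r = a * θ ^ e) (ha : 1 ≤ a)
    (haθ : a < θ) (he : 1 ≤ e) : Real.log r ≤ 2 * e * Real.log θ := by
  have h1 : 0 < Real.log θ := Real.log_pos hθ
  have h2 : Real.log a ≤ Real.log θ := Real.log_le_log (by linarith) haθ.le
  have h3 : (1 : ℝ) ≤ e := mod_cast he
  rw [hr, Real.log_mul (by linarith) (by positivity), Real.log_pow]
  nlinarith

theorem div_div_lt {e₁ e₂ q : ℕ} {c : ℝ} (hc : 0 ≤ c) (hl : 0 < e₂ / q)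
    (h : (e₁ : ℝ) ≤ c * e₂) : ((e₁ / q : ℕ) : ℝ) / (e₂ / q : ℕ) < 2 * c + 1 := by
  have hq : 0 < q := by
    rcases q.eq_zero_or_pos with rfl | hq
    · simp at hl
    · exact hq
  have hl' : (1 : ℝ) ≤ (e₂ / q : ℕ) := mod_cast hl
  have h1 : (q : ℝ) * (e₁ / q : ℕ) ≤ e₁ := mod_cast Nat.mul_div_le e₁ q
  have h2 : (e₂ : ℝ) ≤ q * ((e₂ / q : ℕ) + 1) := mod_cast (Nat.lt_mul_div_succ e₂ hq).le
  have hq' : (0 : ℝ) < q := mod_cast hq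
  rw [div_lt_iff₀ (by linarith)]
  have h3 : ((e₁ / q : ℕ) : ℝ) ≤ c * ((e₂ / q : ℕ) + 1) := by
    refine le_of_mul_le_mul_left ?_ hq'
    calc _ ≤ c * (q * ((e₂ / q : ℕ) + 1)) := h1.trans (h.trans (by gcongr))
      _ = _ := by ring
  -- The rounded-down quotient l is at least 1, so c(l + 1) ≤ 2cl < (2c + 1)l.
  nlinarith

theorem floor_le_div_pow_and_le {e N i c : ℕ} (hN : 0 < N) (hi : 2 ≤ i) (hic : i ≤ c) :
    ⌊(e : ℝ) / (N : ℝ) ^ c⌋₊ ≤ e / N ^ i ∧ ((e / N ^ i : ℕ) : ℝ) ≤ (e : ℝ) / (N : ℝ) ^ 2 := by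
  constructor
  · rw [← Nat.cast_pow, Nat.floor_div_natCast, Nat.floor_natCast]
    exact Nat.div_le_div_left (Nat.pow_le_pow_right hN hic) (by positivity)
  · refine Nat.cast_div_le.trans ?_
    rw [Nat.cast_pow]
    have : (1 : ℝ) ≤ N := mod_cast hN
    gcongr

/-! ### The main theorem -/

theorem mainTheorem3 (lam₁ lam₂ : ℝ)
    (hlam₁ : lam₁ ∈ Set.Ioo (0 : ℝ) 1 \ {1 / 2}) (hlam₂ : lam₂ ∈ Set.Ioo (0 : ℝ) 1 \ {1 / 2})
    (θ₁ θ₂ : ℝ) (hθ₁ : θ₁ = lam₁⁻¹) (hθ₂ : θ₂ = lam₂⁻¹)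
    (hP₁ : IsPisot θ₁) (hP₂ : IsPisot θ₂)
    (δ B : ℝ) (hδ : 0 < δ) (hB : 1 < B) :
    ∃ (C₂ : ℕ) (C₃ C₄ C₅ C₆ C₇ : ℝ),
      2 ≤ C₂ ∧ 0 < C₃ ∧ 0 < C₄ ∧ 0 < C₅ ∧ 0 < C₆ ∧ 0 < C₇ ∧
      ∀ (r s : ℕ → ℝ), Tendsto r atTop atTop → Tendsto s atTop atTop →
        (∀ n, δ ≤ |salemG lam₁ (r n) * salemG lam₂ (s n)|) →
        (∀ n, r n ^ (1 / B) ≤ s n ∧ s n ≤ r n ^ B) →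
      ∀ (a b : ℕ → ℝ) (e₁ e₂ : ℕ → ℕ),
        (∀ᶠ n in atTop, r n = a n * θ₁ ^ e₁ n ∧ 1 ≤ a n ∧ a n < θ₁) →
        (∀ᶠ n in atTop, s n = b n * θ₂ ^ e₂ n ∧ 1 ≤ b n ∧ b n < θ₂) →
      ∀ N : ℕ, 2 < N →
      ∀ᶠ n in atTop, ∃ (k l : ℕ) (α β : ℝ),
        0 < k ∧ 0 < l ∧ α ∈ ℚ⟮θ₁⟯ ∧ β ∈ ℚ⟮θ₂⟯ ∧
        (⌊(e₁ n : ℝ) / (N : ℝ) ^ C₂⌋₊ ≤ k ∧ (k : ℝ) ≤ (e₁ n : ℝ) / (N : ℝ) ^ 2) ∧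
        (⌊(e₂ n : ℝ) / (N : ℝ) ^ C₂⌋₊ ≤ l ∧ (l : ℝ) ≤ (e₂ n : ℝ) / (N : ℝ) ^ 2) ∧
        (1 / C₃ < (k : ℝ) / (l : ℝ) ∧ (k : ℝ) / (l : ℝ) < C₃) ∧
        (|a n - α| ≤ C₅ / θ₁ ^ ((N - 2) * k) ∧
          NumberField.absMulHeight₁ α ≤ C₄ * θ₁ ^ (2 * k)) ∧
        (|b n - β| ≤ C₆ / θ₂ ^ ((N - 2) * l) ∧
          NumberField.absMulHeight₁ β ≤ C₇ * θ₂ ^ (2 * l)) ∧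
        (1 / 2 < α ∧ α < θ₁ + 1 / 2) ∧ (1 / 2 < β ∧ β < θ₂ + 1 / 2) := by
  have hL₁ : 0 < Real.log θ₁ := Real.log_pos hP₁.1
  have hL₂ : 0 < Real.log θ₂ := Real.log_pos hP₂.1
  obtain ⟨ε₁, C₄, C₅, K₁, hε₁, hε₁', hC₄, hC₅, happ₁⟩ := hP₁.exists_approx
  obtain ⟨ε₂, C₇, C₆, K₂, hε₂, hε₂', hC₇, hC₆, happ₂⟩ := hP₂.exists_approx
  obtain ⟨M₁, hM₁⟩ := exists_card_far_from_int_le hP₁.1 hδ hε₁ hε₁'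
  obtain ⟨M₂, hM₂⟩ := exists_card_far_from_int_le hP₂.1 hδ hε₂ hε₂'
  -- Bounds both e₁/e₂ and e₂/e₁: B compares log r with log s, and 2 absorbs the mantissas a and b.
  let c : ℝ := 2 * B * (Real.log θ₂ / Real.log θ₁ + Real.log θ₁ / Real.log θ₂)
  have hc : 0 < c := by positivity
  refine ⟨M₁ + M₂ + 2, 2 * c + 1, C₄, C₅, C₆, C₇, by omega, by positivity, hC₄, hC₅, hC₆, hC₇, ?_⟩
  intro r s hr hs hG hrs a b e₁ e₂ ha hb N hN
  have hN0 : 0 < N := by omega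
  set Q := N ^ (M₁ + M₂ + 2) with hQ
  have hQ0 : 0 < Q := by positivity
  filter_upwards [ha, hb, hr.eventually_gt_atTop 1, hs.eventually_gt_atTop 1,
    -- Q is the largest possible N^i, so k ≥ K₁ + 1 whichever window is selected; the +1 also gives
    -- k > 0.
    eventually_le_exponent hP₁.1 hr ha ((K₁ + 1) * Q),
    eventually_le_exponent hP₂.1 hs hb ((K₂ + 1) * Q)]
    with n ⟨hrn, ha1, ha2⟩ ⟨hsn, hb1, hb2⟩ hr1 hs1 he₁ he₂
  have hG1 : |salemG lam₁ (r n)| ≤ 1 := abs_salemG_le_one hlam₁.1.1 hlam₁.1.2 _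
  have hG2 : |salemG lam₂ (s n)| ≤ 1 := abs_salemG_le_one hlam₂.1.1 hlam₂.1.2 _
  have hGn := hG n
  rw [abs_mul] at hGn
  have hG₁ : δ ≤ |salemG θ₁⁻¹ (a n * θ₁ ^ e₁ n)| := by
    rw [← hrn, hθ₁, inv_inv]
    exact hGn.trans (mul_le_of_le_one_right (abs_nonneg _) hG2)
  have hG₂ : δ ≤ |salemG θ₂⁻¹ (b n * θ₂ ^ e₂ n)| := by
    rw [← hsn, hθ₂, inv_inv]
    exact hGn.trans (mul_le_of_le_one_left (abs_nonneg _) hG1)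
  obtain ⟨i, hi2, hic, hw₁, hw₂⟩ :=
    exists_common_window (N := N) (hM₁ (a n) (e₁ n) hG₁) (hM₂ (b n) (e₂ n) hG₂)
  simp only [not_le] at hw₁ hw₂
  have hdiv {e K : ℕ} (h : (K + 1) * Q ≤ e) : K + 1 ≤ e / N ^ i :=
    ((Nat.le_div_iff_mul_le hQ0).mpr h).trans
      (Nat.div_le_div_left (Nat.pow_le_pow_right hN0 hic) (by positivity))
  have hk := hdiv he₁
  have hl := hdiv he₂
  obtain ⟨α, hα, hα1, hα2, hα3⟩ := happ₁ (a n) N _ ha1 ha2 hN (by omega) hw₁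
  obtain ⟨β, hβ, hβ1, hβ2, hβ3⟩ := happ₂ (b n) N _ hb1 hb2 hN (by omega) hw₂
  have he₁' : 1 ≤ e₁ n := (by omega : 1 ≤ e₁ n / N ^ i).trans (Nat.div_le_self _ _)
  have he₂' : 1 ≤ e₂ n := (by omega : 1 ≤ e₂ n / N ^ i).trans (Nat.div_le_self _ _)
  have hlog₁ : Real.log (s n) ≤ B * Real.log (r n) := by
    rw [← Real.log_rpow (by linarith)]
    exact Real.log_le_log (by linarith) (hrs n).2
  have hlog₂ : Real.log (r n) ≤ B * Real.log (s n) := by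
    have := Real.log_le_log (by positivity) (hrs n).1
    rwa [Real.log_rpow (by linarith), one_div_mul_eq_div, div_le_iff₀' (by linarith)] at this
  have hcmp₁ : (e₁ n : ℝ) ≤ c * e₂ n := by
    have h1 := (mul_log_le_log hP₁.1 hrn ha1).trans (hlog₂.trans
      (mul_le_mul_of_nonneg_left (log_le_two_mul_log hP₂.1 hsn hb1 hb2 he₂') (by linarith)))
    rw [← le_div_iff₀ hL₁] at h1
    refine h1.trans ?_
    have h2 : B * (2 * e₂ n * Real.log θ₂) / Real.log θ₁ =
        2 * B * (Real.log θ₂ / Real.log θ₁) * e₂ n := by ring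
    rw [h2]
    simp only [c]
    gcongr
    exact le_add_of_nonneg_right (by positivity)
  have hcmp₂ : (e₂ n : ℝ) ≤ c * e₁ n := by
    have h1 := (mul_log_le_log hP₂.1 hsn hb1).trans (hlog₁.trans
      (mul_le_mul_of_nonneg_left (log_le_two_mul_log hP₁.1 hrn ha1 ha2 he₁') (by linarith)))
    rw [← le_div_iff₀ hL₂] at h1
    refine h1.trans ?_
    have h2 : B * (2 * e₁ n * Real.log θ₁) / Real.log θ₂ =
        2 * B * (Real.log θ₁ / Real.log θ₂) * e₁ n := by ring
    rw [h2]
    simp only [c]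
    gcongr
    exact le_add_of_nonneg_left (by positivity)
  have hk0 : 0 < e₁ n / N ^ i := by omega
  have hl0 : 0 < e₂ n / N ^ i := by omega
  refine ⟨e₁ n / N ^ i, e₂ n / N ^ i, α, β, hk0, hl0, hα, hβ,
    floor_le_div_pow_and_le hN0 hi2 hic, floor_le_div_pow_and_le hN0 hi2 hic,
    ⟨?_, div_div_lt hc.le hl0 hcmp₁⟩, ⟨hα1, hα2⟩, ⟨hβ1, hβ2⟩, hα3, hβ3⟩
  have h1 := div_div_lt hc.le hk0 hcmp₂
  have hkR : (0 : ℝ) < (e₁ n / N ^ i : ℕ) := mod_cast hk0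
  have hlR : (0 : ℝ) < (e₂ n / N ^ i : ℕ) := mod_cast hl0
  rw [← one_div_div ((e₂ n / N ^ i : ℕ) : ℝ)]
  exact one_div_lt_one_div_of_lt (by positivity) h1
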